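/- Let $\mathcal D$ be the set of dyadic intervals $[k2^{-n},(k+1)2^{-n})$, $k,n\in\mathbb Z$, of the real line. For $I\in\mathcal D$ let $I_-,I_+$ be its left and right halves, $|I|$ its length, $\langle f\rangle_I=\frac1{|I|}\int_I f\,dx$, and $h_I=|I|^{-1/2}(\chi_{I_-}-\chi_{I_+})$. Let $v,w$ be weights on $\mathbb R$, i.e. locally integrable functions that are positive almost everywhere, and put $$\alpha_I=\left|\frac{\langle v\rangle_{I_-}-\langle v\rangle_{I_+}}{\langle v\rangle_I}\right|\left|\frac{\langle w\rangle_{I_-}-\langle w\rangle_{I_+}}{\langle w\rangle_I}\right||I|.$$ A weight $u$ is in $A_\infty$ if for every $\varepsilon>0$ there is $\delta>0$ such that, for every bounded interval $I$ and every measurable $E\subset I$, $|E|\le\delta|I|$ implies $\int_E u\le\varepsilon\int_I u$. Consider the conditions (each for some finite $C$) $$\text{(1.1)}\quad \langle v\rangle_J\langle w\rangle_J\le C\quad\text{for all }J\in\mathcal D;$$ $$\text{(1.2)}\quad \frac1{|J|}\sum_{I\in\mathcal D,\,I\subseteq J}|\langle w\rangle_{I_-}-\langle w\rangle_{I_+}|^2\langle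 v\rangle_I|I|\le C\langle w\rangle_J\quad\text{for all }J\in\mathcal D;$$ $$\text{(1.3)}\quad \frac1{|J|}\sum_{I\in\mathcal D,\,I\subseteq J}|\langle v\rangle_{I_-}-\langle v\rangle_{I_+}|^2\langle w\rangle_I|I|\le C\langle v\rangle_J\quad\text{for all }J\in\mathcal D.$$ **Theorem 3.1.** Suppose that (1.2) and (1.3) hold and that at least one of $v$, $w$ is in $A_\infty$. Then there is a constant $C$ such that for all real-valued $f,g\in L^2(\mathbb R)$ $$\text{(2.7)}\quad \sum_{I\in\mathcal D}|\langle gv^{1/2}\rangle_I|\,|\langle fw^{1/2}\rangle_I|\,\alpha_I\le C\|f\|_2\|g\|_2,$$ and the operator $T_0f=\sum_{I\in\mathcal D}\frac1{|I|}\langle f\rangle_I\,\alpha_I\,\chi_I$ is bounded from $L^2(w^{-1})$ to $L^2(v)$, the series converging unconditionally in $L^2(v)$. If in addition (1.1) holds, then the Haar multipliers $T_\sigma f=\sum_{I\in\mathcal D}\sigma_I\left(\int f h_I\,dx\right)h_I$, $\sigma_I=\pm1$, are bounded from $L^2(w^{-1})$ to $L^2(v)$ uniformly over all choices of signs $\sigma=(\sigma_I)_{I\in\mathcal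 D}$, the series converging unconditionally in $L^2(v)$. -/

import Mathlib

open MeasureTheory Set
open scoped ENNReal

noncomputable section

namespace HaarTwoWeight

/-- The dyadic interval `[pos * 2 ^ (-scale), (pos + 1) * 2 ^ (-scale))` of the real line. -/
@[ext]
structure DyadicInterval where
  scale : ℤ
  pos : ℤ

namespace DyadicInterval

/-- The length `|I|`. -/
def len (I : DyadicInterval) : ℝ := (2 : ℝ) ^ (-I.scale)

/-- The underlying set of points of a dyadic interval. -/
def toSet (I : DyadicInterval) : Set ℝ := Ico (I.pos * I.len) ((I.pos + 1) * I.len)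

/-- The left half of a dyadic interval. -/
def left (I : DyadicInterval) : DyadicInterval := ⟨I.scale + 1, 2 * I.pos⟩

/-- The right half of a dyadic interval. -/
def right (I : DyadicInterval) : DyadicInterval := ⟨I.scale + 1, 2 * I.pos + 1⟩

/-- The average of `f` over `I` with respect to Lebesgue measure. -/
def avg (f : ℝ → ℝ) (I : DyadicInterval) : ℝ := ⨍ x in I.toSet, f x

/-- The difference of the averages of `f` over the two halves of `I`. -/
def diff (f : ℝ → ℝ) (I : DyadicInterval) : ℝ := avg f I.left - avg f I.right

/-- The characteristic function of `I`. -/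
def chi (I : DyadicInterval) : ℝ → ℝ := I.toSet.indicator fun _ => 1

/-- The Haar function: `|I| ^ (-1/2)` on the left half, `-|I| ^ (-1/2)` on the right half,
zero elsewhere. -/
def haar (I : DyadicInterval) : ℝ → ℝ := fun x => (√I.len)⁻¹ * (chi I.left x - chi I.right x)

end DyadicInterval

open DyadicInterval

/-- A weight: a locally integrable function that is positive almost everywhere. -/
structure IsWeight (w : ℝ → ℝ) : Prop where
  locallyIntegrable : LocallyIntegrable w
  pos : ∀ᵐ x, 0 < w x

/-- The measure `w dx`. -/
def wMeasure (w : ℝ → ℝ) : Measure ℝ := volume.withDensity fun x => ENNReal.ofReal (w x)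

/-- The weighted space `L²(w)` of real functions. -/
abbrev L2 (w : ℝ → ℝ) := Lp ℝ 2 (wMeasure w)

/-- The Muckenhoupt class `A_∞` on the line: uniformly over all bounded intervals `[a, b]`,
subsets of small relative Lebesgue measure have small relative `w`-measure. -/
def IsAInfty (w : ℝ → ℝ) : Prop :=
  ∀ ε : ℝ, 0 < ε → ∃ δ : ℝ, 0 < δ ∧ ∀ a b : ℝ, a < b → ∀ E : Set ℝ, MeasurableSet E →
    E ⊆ Icc a b → volume E ≤ ENNReal.ofReal δ * volume (Icc a b) →
      wMeasure w E ≤ ENNReal.ofReal ε * wMeasure w (Icc a b)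

/-- The joint two-weight Muckenhoupt condition over dyadic intervals. -/
def JointA2 (v w : ℝ → ℝ) : Prop :=
  ∃ C : ℝ, ∀ I : DyadicInterval, avg v I * avg w I ≤ C

/-- The square-function testing condition for `w` against `v`:
`|J|⁻¹ ∑_{I ⊆ J} |⟨w⟩_{I₋} - ⟨w⟩_{I₊}|² ⟨v⟩_I |I| ≤ C ⟨w⟩_J` for all dyadic `J`. The sum of
nonnegative terms is taken in `[0, ∞]`, so its finiteness is part of the condition. -/
def SquareTesting (w v : ℝ → ℝ) : Prop :=
  ∃ C : ℝ, ∀ J : DyadicInterval,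
    ENNReal.ofReal (1 / J.len) *
      ∑' I : {I : DyadicInterval // I.toSet ⊆ J.toSet},
        ENNReal.ofReal (|diff w I.1| ^ 2 * avg v I.1 * I.1.len)
      ≤ ENNReal.ofReal (C * avg w J)

/-- The coefficient `α_I`. -/
def alpha (v w : ℝ → ℝ) (I : DyadicInterval) : ℝ :=
  |diff v I / avg v I| * |diff w I / avg w I| * I.len

/-- The bilinear estimate, with one constant for all `f, g ∈ L²(ℝ)`; the sum of nonnegative terms
is taken in `[0, ∞]`. -/
def BilinearEstimate (v w : ℝ → ℝ) : Prop :=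
  ∃ C : ℝ, ∀ f g : ℝ → ℝ, MemLp f 2 volume → MemLp g 2 volume →
    ∑' I : DyadicInterval, ENNReal.ofReal
        (|avg (fun x => g x * √(v x)) I| * |avg (fun x => f x * √(w x)) I| * alpha v w I)
      ≤ ENNReal.ofReal C * eLpNorm f 2 volume * eLpNorm g 2 volume

theorem wMeasure_toSet_lt_top {v : ℝ → ℝ} (hv : IsWeight v) (I : DyadicInterval) :
    wMeasure v I.toSet < ∞ := by
  have hm : MeasurableSet I.toSet := measurableSet_Ico
  have hi : IntegrableOn v I.toSet :=
    (hv.locallyIntegrable.integrableOn_isCompact isCompact_Icc).mono_set Ico_subset_Icc_self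
  rw [wMeasure, withDensity_apply _ hm]
  exact hi.lintegral_lt_top

theorem memLp_chi {v : ℝ → ℝ} (hv : IsWeight v) (I : DyadicInterval) :
    MemLp I.chi 2 (wMeasure v) :=
  memLp_indicator_const 2 measurableSet_Ico 1 (Or.inr (wMeasure_toSet_lt_top hv I).ne)

theorem memLp_haar {v : ℝ → ℝ} (hv : IsWeight v) (I : DyadicInterval) :
    MemLp I.haar 2 (wMeasure v) :=
  ((memLp_chi hv I.left).sub (memLp_chi hv I.right)).const_mul _

/-- `T f = ∑_I |I|⁻¹ ⟨f⟩_I α_I χ_I` defines a bounded operator from `L²(w⁻¹)` to `L²(v)`, where the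
series converges unconditionally in `L²(v)` for every `f`. -/
def T0Bounded (v w : ℝ → ℝ) (hv : IsWeight v) : Prop :=
  ∃ T : L2 (fun x => (w x)⁻¹) →L[ℝ] L2 v, ∀ f : L2 (fun x => (w x)⁻¹),
    HasSum (fun I : DyadicInterval =>
      (1 / I.len * avg f I * alpha v w I) • (memLp_chi hv I).toLp I.chi) (T f)

/-- The Haar multipliers `T_σ f = ∑_I σ_I (f, h_I) h_I` are bounded from `L²(w⁻¹)` to `L²(v)`,
uniformly in the choice of signs `σ`, where the series converges unconditionally in `L²(v)` for
every `f`. -/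
def HaarMultipliersUniformlyBounded (v w : ℝ → ℝ) (hv : IsWeight v) : Prop :=
  ∃ C : ℝ, ∀ σ : DyadicInterval → ℝ, (∀ I, σ I = 1 ∨ σ I = -1) →
    ∃ T : L2 (fun x => (w x)⁻¹) →L[ℝ] L2 v, ‖T‖ ≤ C ∧ ∀ f : L2 (fun x => (w x)⁻¹),
      HasSum (fun I : DyadicInterval =>
        (σ I * ∫ x, f x * I.haar x) • (memLp_haar hv I).toLp I.haar) (T f)

end HaarTwoWeight

end

/-! Put `φ = f w^{-1/2}` and `ψ = g v^{1/2}`, for `f` in `L²(w⁻¹)` and `g` in `L²(v)`, so that both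
operator bounds become bilinear estimates in unweighted `L²`. Dividing the averages of `φ√w` and
`ψ√v` by those of `w` and `v` cancels the denominators of `alpha` (`bilinear_term_eq`). If `w` is in
`A_∞`, Cauchy–Schwarz splits the sum into two square sums, with weights `|diff v|² ⟨w⟩_I |I|` and
`|diff w|² |I| / ⟨w⟩_I`. Each is handled by `carleson_embedding`: the packing condition of the first
is square testing, that of the second follows from `A_∞` by a stopping-time argument
(`exists_sum_relVariation_le`). The other case is symmetric.

For Haar multipliers, each Haar coefficient splits into a coefficient along a weight-adapted Haar
function and an averaging part (`abs_integral_mul_haar_le`). The product of two such splittings has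
four terms: the adapted pair is controlled by the joint `A₂` condition and Bessel, the mixed ones by
square testing, Carleson embedding and Bessel, and the last is the bilinear sum above.

These estimates bound finite sums of absolute values. In a Hilbert space this already forces
unconditional convergence and a bounded sum operator (`exists_clm_hasSum`). -/

noncomputable section

/-! ### Dyadic intervals and finite dyadic trees. -/

namespace HaarTwoWeight
namespace DyadicInterval

theorem len_pos (I : DyadicInterval) : 0 < I.len := zpow_pos two_pos _

theorem len_eq_two_mul (I : DyadicInterval) (k : ℤ) :
    I.len = 2 * (⟨I.scale + 1, k⟩ : DyadicInterval).len := by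
  simp only [len]
  rw [show -I.scale = -(I.scale + 1) + 1 by ring, zpow_add_one₀ two_ne_zero]
  ring_nf

theorem len_left (I : DyadicInterval) : I.left.len = I.len / 2 := by
  have := I.len_eq_two_mul (2 * I.pos)
  simp only [left]; linarith

theorem len_right (I : DyadicInterval) : I.right.len = I.len / 2 := by
  have := I.len_eq_two_mul (2 * I.pos + 1)
  simp only [right]; linarith

theorem measurableSet_toSet (I : DyadicInterval) : MeasurableSet I.toSet := measurableSet_Ico

theorem left_endpoint_lt (I : DyadicInterval) : I.pos * I.len < (I.pos + 1) * I.len := by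
  nlinarith [I.len_pos]

theorem toSet_nonempty (I : DyadicInterval) : I.toSet.Nonempty :=
  nonempty_Ico.2 I.left_endpoint_lt

theorem volume_toSet (I : DyadicInterval) : volume I.toSet = ENNReal.ofReal I.len := by
  rw [toSet, Real.volume_Ico]; congr 1; ring

theorem volume_real_toSet (I : DyadicInterval) : volume.real I.toSet = I.len := by
  rw [Measure.real, volume_toSet, ENNReal.toReal_ofReal I.len_pos.le]

theorem toSet_left (I : DyadicInterval) :
    I.left.toSet = Ico (I.pos * I.len) ((I.pos + 1 / 2) * I.len) := by
  rw [toSet, len_left]; simp only [left]; push_cast; congr 1 <;> ring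

theorem toSet_right (I : DyadicInterval) :
    I.right.toSet = Ico ((I.pos + 1 / 2) * I.len) ((I.pos + 1) * I.len) := by
  rw [toSet, len_right]; simp only [right]; push_cast; congr 1 <;> ring

theorem left_union_right (I : DyadicInterval) : I.left.toSet ∪ I.right.toSet = I.toSet := by
  have := I.len_pos
  rw [toSet_left, toSet_right, Ico_union_Ico_eq_Ico (by nlinarith) (by nlinarith), toSet]

theorem disjoint_left_right (I : DyadicInterval) : Disjoint I.left.toSet I.right.toSet := by
  rw [toSet_left, toSet_right]
  exact Ico_disjoint_Ico_same

theorem left_subset (I : DyadicInterval) : I.left.toSet ⊆ I.toSet :=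
  I.left_union_right ▸ subset_union_left

theorem right_subset (I : DyadicInterval) : I.right.toSet ⊆ I.toSet :=
  I.left_union_right ▸ subset_union_right

open Classical in
/-- The dyadic subintervals of `J` of the first `n` generations, starting with `J` itself. -/
def desc : ℕ → DyadicInterval → Finset DyadicInterval
  | 0, _ => ∅
  | n + 1, J => insert J (desc n J.left ∪ desc n J.right)

theorem scale_le_of_mem_desc {n : ℕ} {I J : DyadicInterval} (h : I ∈ desc n J) :
    J.scale ≤ I.scale := by
  induction n generalizing J with
  | zero => simp [desc] at h
  | succ n ih =>
    simp only [desc, Finset.mem_insert, Finset.mem_union] at h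
    rcases h with rfl | h | h
    · rfl
    · have := ih h; simp only [left] at this; lia
    · have := ih h; simp only [right] at this; lia

theorem subset_of_mem_desc {n : ℕ} {I J : DyadicInterval} (h : I ∈ desc n J) :
    I.toSet ⊆ J.toSet := by
  induction n generalizing J with
  | zero => simp [desc] at h
  | succ n ih =>
    simp only [desc, Finset.mem_insert, Finset.mem_union] at h
    rcases h with rfl | h | h
    · rfl
    · exact (ih h).trans J.left_subset
    · exact (ih h).trans J.right_subset

/-- Floor division by `2 ^ k` gives the position of the ancestor `k` generations up; its last step
records left or right by parity. -/
theorem mem_desc {n k : ℕ} (hk : k < n) {I J : DyadicInterval} (hs : I.scale = J.scale + k)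
    (hp : I.pos / 2 ^ k = J.pos) : I ∈ desc n J := by
  induction n generalizing k J with
  | zero => lia
  | succ n ih =>
    simp only [desc, Finset.mem_insert, Finset.mem_union]
    rcases k with _ | k
    · left; ext <;> simp_all
    · right
      rw [pow_succ, ← Int.ediv_ediv_of_nonneg (by positivity)] at hp
      push_cast at hs
      rcases Int.emod_two_eq_zero_or_one (I.pos / 2 ^ k) with h | h
      · left
        exact ih (k := k) (by lia) (by simp only [left]; lia) (by simp only [left]; lia)
      · right
        exact ih (k := k) (by lia) (by simp only [right]; lia) (by simp only [right]; lia)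

theorem sum_desc_succ (c : DyadicInterval → ℝ) (n : ℕ) (J : DyadicInterval) :
    ∑ I ∈ desc (n + 1) J, c I = c J + (∑ I ∈ desc n J.left, c I + ∑ I ∈ desc n J.right, c I) := by
  classical
  rw [desc, Finset.sum_insert, Finset.sum_union]
  · rw [Finset.disjoint_left]
    intro I h1 h2
    obtain ⟨x, hx⟩ := I.toSet_nonempty
    exact disjoint_left.1 J.disjoint_left_right (subset_of_mem_desc h1 hx) (subset_of_mem_desc h2 hx)
  · rw [Finset.mem_union]
    rintro (h | h)
    · have := scale_le_of_mem_desc h; simp [left] at this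
    · have := scale_le_of_mem_desc h; simp [right] at this

/-- Two trees are needed because no dyadic interval crosses the origin: the tops are `[0, 2^N)` and
`[-2^N, 0)` with `N` large. -/
theorem exists_desc_cover (s : Finset DyadicInterval) : ∃ (n : ℕ) (J K : DyadicInterval),
    Disjoint J.toSet K.toSet ∧ ∀ I ∈ s, I ∈ desc n J ∨ I ∈ desc n K := by
  have key : ∀ I : DyadicInterval, ∀ᶠ N : ℕ in Filter.atTop,
      I ∈ desc (2 * N + 1) ⟨-N, 0⟩ ∨ I ∈ desc (2 * N + 1) ⟨-N, -1⟩ := by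
    intro I
    filter_upwards [Filter.eventually_ge_atTop (I.scale.natAbs + I.pos.natAbs)] with N hN
    obtain ⟨k, hk⟩ : ∃ k : ℕ, I.scale + N = k := ⟨(I.scale + N).toNat, by lia⟩
    have h1 : (I.pos.natAbs : ℤ) < 2 ^ k := by
      calc (I.pos.natAbs : ℤ) ≤ k := by lia
        _ < 2 ^ k := by exact_mod_cast Nat.lt_two_pow_self
    rcases le_or_gt 0 I.pos with h | h
    · left
      refine mem_desc (k := k) (by lia) (by simp only; lia) ?_
      exact Int.ediv_eq_zero_of_lt h (by lia)
    · right
      refine mem_desc (k := k) (by lia) (by simp only; lia) ?_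
      exact Int.ediv_eq_neg_one_of_neg_of_le h (by lia)
  obtain ⟨N, hN⟩ := ((Filter.eventually_all_finset s).2 fun I _ => key I).exists
  refine ⟨_, _, _, ?_, hN⟩
  simp only [toSet, len]
  rw [disjoint_left]
  simp
  intro a h1 _ _
  exact h1

/-- A function on dyadic intervals that is additive over the two halves. -/
def IsAdditive (p : DyadicInterval → ℝ) : Prop := ∀ I, p I = p I.left + p I.right

theorem isAdditive_setIntegral {u : ℝ → ℝ} (hu : ∀ I : DyadicInterval, IntegrableOn u I.toSet) :
    IsAdditive fun I => ∫ x in I.toSet, u x := fun I => by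
  simp only
  rw [← setIntegral_union I.disjoint_left_right I.right.measurableSet_toSet (hu _) (hu _),
    left_union_right]

theorem avg_eq (u : ℝ → ℝ) (I : DyadicInterval) : avg u I = (∫ x in I.toSet, u x) / I.len := by
  rw [avg, setAverage_eq, volume_real_toSet, smul_eq_mul, div_eq_inv_mul]

theorem diff_eq (u : ℝ → ℝ) (I : DyadicInterval) :
    diff u I = 2 * ((∫ x in I.left.toSet, u x) - ∫ x in I.right.toSet, u x) / I.len := by
  have := I.len_pos
  rw [diff, avg_eq, avg_eq, len_left, len_right]; field_simp

/-- Passes from estimates on finite trees, provable by induction on depth, to arbitrary finite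
families. -/
theorem sum_le_integral {c : DyadicInterval → ℝ} (hc : ∀ I, 0 ≤ c I) {Φ : ℝ → ℝ}
    (hΦ : Integrable Φ) (hΦ0 : 0 ≤ Φ) {C : ℝ} (hC : 0 ≤ C)
    (h : ∀ n J, ∑ I ∈ desc n J, c I ≤ C * ∫ x in J.toSet, Φ x) (s : Finset DyadicInterval) :
    ∑ I ∈ s, c I ≤ C * ∫ x, Φ x := by
  classical
  obtain ⟨n, J, K, hd, hs⟩ := exists_desc_cover s
  calc ∑ I ∈ s, c I ≤ ∑ I ∈ desc n J ∪ desc n K, c I :=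
        Finset.sum_le_sum_of_subset_of_nonneg (fun I hI => Finset.mem_union.2 (hs I hI))
          fun I _ _ => hc I
    _ ≤ ∑ I ∈ desc n J, c I + ∑ I ∈ desc n K, c I := by
        rw [← Finset.sum_union_inter]
        exact le_add_of_nonneg_right (Finset.sum_nonneg fun I _ => hc I)
    _ ≤ C * (∫ x in J.toSet, Φ x) + C * ∫ x in K.toSet, Φ x := add_le_add (h n J) (h n K)
    _ = C * ∫ x in J.toSet ∪ K.toSet, Φ x := by
        rw [setIntegral_union hd K.measurableSet_toSet hΦ.integrableOn hΦ.integrableOn]; ring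
    _ ≤ C * ∫ x, Φ x := by
        exact mul_le_mul_of_nonneg_left
          (setIntegral_le_integral hΦ (Filter.Eventually.of_forall hΦ0)) hC

end DyadicInterval
end HaarTwoWeight

/-! ### Carleson embedding and the weighted Bessel inequality. -/

namespace HaarTwoWeight
namespace DyadicInterval

/-- Convexity of the homogeneous function `p² / P`. It drives the Bellman induction and the
positivity of `haarEnergy`. -/
theorem add_sq_div_add_le {p q P Q : ℝ} (hP : 0 < P) (hQ : 0 < Q) :
    (p + q) ^ 2 / (P + Q) ≤ p ^ 2 / P + q ^ 2 / Q := by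
  rw [div_add_div _ _ hP.ne' hQ.ne', div_le_div_iff₀ (by positivity) (by positivity)]
  nlinarith [mul_nonneg hP.le (sq_nonneg (p * Q - q * P)),
    mul_nonneg hQ.le (sq_nonneg (p * Q - q * P))]

variable {w p Φ : DyadicInterval → ℝ}

/-- The weighted dyadic Carleson embedding theorem, for trees of finite depth. -/
theorem carleson_embedding (hw : IsAdditive w) (hw0 : ∀ I, 0 < w I) (hp : IsAdditive p)
    (hΦ : IsAdditive Φ) (hpΦ : ∀ I, p I ^ 2 ≤ w I * Φ I) {a : DyadicInterval → ℝ}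
    (ha : ∀ I, 0 ≤ a I) {C : ℝ} (hC : 0 < C) (h : ∀ n J, ∑ I ∈ desc n J, a I ≤ C * w J)
    (n : ℕ) (J : DyadicInterval) :
    ∑ I ∈ desc n J, a I * (p I / w I) ^ 2 ≤ 4 * C * Φ J := by
  -- The Bellman function is `4C (Φ - p² / (w + M))`, where `M ≤ w` is the Carleson mass of the tree
  -- divided by `C`.
  have key : ∑ I ∈ desc n J, a I * (p I / w I) ^ 2 ≤
      4 * C * (Φ J - p J ^ 2 / (w J + (∑ I ∈ desc n J, a I) / C)) := by
    induction n generalizing J with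
    | zero =>
      simp only [desc, Finset.sum_empty, zero_div, add_zero]
      have : p J ^ 2 / w J ≤ Φ J := by
        rw [div_le_iff₀ (hw0 J), mul_comm]; exact hpΦ J
      have : 0 ≤ Φ J - p J ^ 2 / w J := by linarith
      positivity
    | succ n ih =>
      have hA := h (n + 1) J
      rw [sum_desc_succ] at hA ⊢
      rw [sum_desc_succ]
      have hl := ih J.left
      have hr := ih J.right
      set A := ∑ I ∈ desc n J.left, a I with hAdef
      set B := ∑ I ∈ desc n J.right, a I with hBdef
      have hA0 : 0 ≤ A := Finset.sum_nonneg fun I _ => ha I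
      have hB0 : 0 ≤ B := Finset.sum_nonneg fun I _ => ha I
      have ha0 := ha J
      have hwl := hw0 J.left
      have hwr := hw0 J.right
      have hwJ := hw0 J
      have e := add_sq_div_add_le (p := p J.left) (q := p J.right)
        (P := w J.left + A / C) (Q := w J.right + B / C) (by positivity) (by positivity)
      rw [← hp J, show w J.left + A / C + (w J.right + B / C) = w J + (A + B) / C by
        rw [hw J]; ring] at e
      have hΦJ := hΦ J
      set X := w J + (A + B) / C with hX
      have hX0 : 0 < X := by positivity
      have hXw : X + a J / C ≤ 2 * w J := by
        have : (a J + (A + B)) / C ≤ w J := by rw [div_le_iff₀ hC, mul_comm]; exact hA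
        have e2 : (a J + (A + B)) / C = a J / C + (A + B) / C := by ring
        linarith
      have hY : w J + (a J + (A + B)) / C = X + a J / C := by rw [hX]; ring
      rw [hY]
      have hac : 0 ≤ a J / C := by positivity
      -- Adding the mass of `J` itself to the denominator pays for the top term. Both denominators
      -- are at most `2 w J`, hence the constant 4.
      have gain : a J * (p J / w J) ^ 2 ≤ 4 * C * (p J ^ 2 / X - p J ^ 2 / (X + a J / C)) := by
        have e3 : 4 * C * (p J ^ 2 / X - p J ^ 2 / (X + a J / C)) =
            4 * (a J * p J ^ 2) / (X * (X + a J / C)) := by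
          have : X + a J / C ≠ 0 := by positivity
          rw [div_sub_div _ _ hX0.ne' this]
          field_simp
          ring
        rw [e3, div_pow, ← mul_div_assoc, div_le_div_iff₀ (by positivity) (by positivity)]
        have : X * (X + a J / C) ≤ 4 * w J ^ 2 := by nlinarith
        have h0 : 0 ≤ a J * p J ^ 2 := by positivity
        nlinarith
      have e' := mul_le_mul_of_nonneg_left e (show 0 ≤ 4 * C by positivity)
      rw [hΦJ]
      linarith
  refine key.trans ?_
  have h0 : 0 ≤ ∑ I ∈ desc n J, a I := Finset.sum_nonneg fun I _ => ha I
  have := hw0 J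
  have : 0 ≤ p J ^ 2 / (w J + (∑ I ∈ desc n J, a I) / C) := by positivity
  have := mul_nonneg hC.le this
  linarith

/-- The square of the coefficient of `p / w` along the Haar function of `I` adapted to `w`. -/
def haarEnergy (w p : DyadicInterval → ℝ) (I : DyadicInterval) : ℝ :=
  p I.left ^ 2 / w I.left + p I.right ^ 2 / w I.right - p I ^ 2 / w I

/-- Bessel's inequality: the energies telescope, and `p² / w ≤ Φ` bounds the contribution of the
last generation. -/
theorem sum_haarEnergy_le (hw0 : ∀ I, 0 < w I) (hΦ : IsAdditive Φ)
    (hpΦ : ∀ I, p I ^ 2 ≤ w I * Φ I) (n : ℕ) (J : DyadicInterval) :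
    ∑ I ∈ desc n J, haarEnergy w p I ≤ Φ J := by
  have key : ∑ I ∈ desc n J, haarEnergy w p I ≤ Φ J - p J ^ 2 / w J := by
    induction n generalizing J with
    | zero =>
      simp only [desc, Finset.sum_empty]
      rw [sub_nonneg, div_le_iff₀ (hw0 J), mul_comm]; exact hpΦ J
    | succ n ih =>
      rw [sum_desc_succ, haarEnergy]
      linarith [ih J.left, ih J.right, hΦ J]
  have : 0 ≤ p J ^ 2 / w J := div_nonneg (sq_nonneg _) (hw0 J).le
  linarith

theorem haarEnergy_nonneg (hw : IsAdditive w) (hw0 : ∀ I, 0 < w I) (hp : IsAdditive p)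
    (I : DyadicInterval) : 0 ≤ haarEnergy w p I := by
  have := add_sq_div_add_le (p := p I.left) (q := p I.right) (hw0 I.left) (hw0 I.right)
  rw [← hw I, ← hp I] at this
  rw [haarEnergy]; linarith

theorem abs_sub_le_sqrt_haarEnergy (hw : IsAdditive w) (hw0 : ∀ I, 0 < w I) (hp : IsAdditive p)
    (I : DyadicInterval) : |p I.left - p I.right| ≤
      √(w I * haarEnergy w p I) + |p I / w I| * |w I.left - w I.right| := by
  have hl := hw0 I.left
  have hr := hw0 I.right
  -- Subtracting from `p` its mean multiple of `w` leaves opposite values on the two halves, hence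
  -- the factor 2.
  have e : p I.left - p I.right =
      2 * (p I.left - p I * w I.left / w I) + p I / w I * (w I.left - w I.right) := by
    have hI := hw0 I
    field_simp
    rw [hw I, hp I]; ring
  rw [e, ← abs_mul]
  refine (abs_add_le _ _).trans (add_le_add_left (Real.abs_le_sqrt ?_) _)
  rw [haarEnergy, hw I, hp I]
  have : 0 < w I.left + w I.right := by positivity
  rw [← sub_nonneg]
  -- The defect is explicit and nonnegative because `4 w₋ w₊ ≤ (w₋ + w₊)²`.
  have e2 : (w I.left + w I.right) * (p I.left ^ 2 / w I.left + p I.right ^ 2 / w I.right -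
      (p I.left + p I.right) ^ 2 / (w I.left + w I.right)) -
      (2 * (p I.left - (p I.left + p I.right) * w I.left / (w I.left + w I.right))) ^ 2 =
      (p I.left * w I.right - p I.right * w I.left) ^ 2 * (w I.left - w I.right) ^ 2 /
        (w I.left * w I.right * (w I.left + w I.right) ^ 2) := by
    field_simp
    ring
  rw [e2]; positivity

end DyadicInterval
end HaarTwoWeight

/-! ### The Carleson condition for `A_∞` weights. -/

namespace HaarTwoWeight

theorem IsWeight.integrableOn_Icc {w : ℝ → ℝ} (hw : IsWeight w) (a b : ℝ) :
    IntegrableOn w (Icc a b) :=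
  hw.locallyIntegrable.integrableOn_isCompact isCompact_Icc

theorem IsWeight.integrableOn_toSet {w : ℝ → ℝ} (hw : IsWeight w) (I : DyadicInterval) :
    IntegrableOn w I.toSet :=
  (hw.integrableOn_Icc _ _).mono_set Ico_subset_Icc_self

theorem IsWeight.wMeasure_eq {w : ℝ → ℝ} (hw : IsWeight w) {E : Set ℝ} (hE : MeasurableSet E)
    (h : IntegrableOn w E) : wMeasure w E = ENNReal.ofReal (∫ x in E, w x) := by
  rw [wMeasure, withDensity_apply _ hE, ofReal_integral_eq_lintegral_ofReal h]
  filter_upwards [ae_restrict_of_ae hw.pos] with x hx using hx.le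

theorem IsWeight.setIntegral_pos {w : ℝ → ℝ} (hw : IsWeight w) (I : DyadicInterval) :
    0 < ∫ x in I.toSet, w x := by
  rw [setIntegral_pos_iff_support_of_nonneg_ae
    (by filter_upwards [ae_restrict_of_ae hw.pos] with x hx using hx.le) (hw.integrableOn_toSet I)]
  have : volume (Function.support w ∩ I.toSet) = volume I.toSet := by
    apply measure_congr
    filter_upwards [hw.pos] with x hx
    have : x ∈ Function.support w := hx.ne'
    apply propext
    change _ ∧ _ ↔ _
    exact ⟨fun h => h.2, fun h => ⟨this, h⟩⟩
  rw [this, I.volume_toSet]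
  exact ENNReal.ofReal_pos.2 I.len_pos

/-- The single value `ε = 1/2` is enough: it makes the recursion over stopping intervals contract.
-/
theorem IsAInfty.exists_setIntegral_le {w : ℝ → ℝ} (hw : IsWeight w) (hA : IsAInfty w) :
    ∃ δ : ℝ, 0 < δ ∧ ∀ (J : DyadicInterval) (E : Set ℝ), MeasurableSet E → E ⊆ J.toSet →
      volume.real E ≤ δ * J.len → ∫ x in E, w x ≤ (1 / 2) * ∫ x in J.toSet, w x := by
  obtain ⟨δ, hδ, h⟩ := hA (1 / 2) (by norm_num)
  refine ⟨δ, hδ, fun J E hE hEJ hvol => ?_⟩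
  have hEI : E ⊆ Icc (J.pos * J.len) ((J.pos + 1) * J.len) := hEJ.trans Ico_subset_Icc_self
  have hfin : volume E ≠ ∞ := by
    refine ne_top_of_le_ne_top ?_ (measure_mono hEJ)
    rw [J.volume_toSet]; exact ENNReal.ofReal_ne_top
  have key := h _ _ J.left_endpoint_lt E hE hEI (by
    rw [Real.volume_Icc, ← ENNReal.ofReal_mul hδ.le, ← ENNReal.ofReal_toReal hfin]
    apply ENNReal.ofReal_le_ofReal
    refine hvol.trans_eq ?_
    ring)
  rw [hw.wMeasure_eq hE ((hw.integrableOn_toSet J).mono_set hEJ),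
    hw.wMeasure_eq measurableSet_Icc (hw.integrableOn_Icc _ _),
    ← ENNReal.ofReal_mul (by norm_num), integral_Icc_eq_integral_Ico] at key
  have hpos := hw.setIntegral_pos J
  exact (ENNReal.ofReal_le_ofReal_iff (by simp only [DyadicInterval.toSet] at hpos; positivity)).1 key

namespace DyadicInterval

/-- The relative square variation of an additive function `w` on the halves of `I`. -/
def relVariation (w : DyadicInterval → ℝ) (I : DyadicInterval) : ℝ :=
  (w I.left - w I.right) ^ 2 / w I

/-- The stopping-time step: descend from `I` until the average of `w` leaves `[m / 4, lam * m]`;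
`E` is the union of the stopping intervals on which the average is large. -/
theorem exists_stopping_bound {w : ℝ → ℝ} (hw : IsWeight w) {m lam K : ℝ} (hm : 0 < m)
    (hlam : 1 ≤ lam) (hK : 0 ≤ K) (N : ℕ)
    (H : ∀ k < N, ∀ I, ∑ L ∈ desc k I, relVariation (fun I => ∫ x in I.toSet, w x) L ≤
      K * ∫ x in I.toSet, w x)
    (n : ℕ) (hn : n ≤ N) (I : DyadicInterval)
    (hI : n < N ∨ (m / 4 * I.len ≤ ∫ x in I.toSet, w x) ∧ ∫ x in I.toSet, w x ≤ lam * m * I.len)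
    (hI2 : ∫ x in I.toSet, w x ≤ 2 * lam * m * I.len) :
    ∃ E ⊆ I.toSet, MeasurableSet E ∧ volume.real E ≤ (∫ x in I.toSet, w x) / (lam * m) ∧
      ∑ L ∈ desc n I, relVariation (fun I => ∫ x in I.toSet, w x) L ≤
        4 / m * ((2 * lam * m) ^ 2 * I.len - (∫ x in I.toSet, w x) ^ 2 / I.len) +
          K * (∫ x in E, w x) + K * (m / 4 * I.len) := by
  have hlm : 0 < lam * m := by positivity
  -- This remaining energy stays nonnegative one generation past the upper threshold, since halving
  -- an interval at most doubles the average.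
  have bracket : ∀ I : DyadicInterval, ∫ x in I.toSet, w x ≤ 2 * lam * m * I.len →
      0 ≤ 4 / m * ((2 * lam * m) ^ 2 * I.len - (∫ x in I.toSet, w x) ^ 2 / I.len) := by
    intro I hI2
    have hl := I.len_pos
    have hp := hw.setIntegral_pos I
    refine mul_nonneg (by positivity) ?_
    rw [sub_nonneg, div_le_iff₀ hl]
    calc _ ≤ (2 * lam * m * I.len) ^ 2 := by gcongr
      _ = _ := by ring
  induction n generalizing I with
  | zero =>
    refine ⟨∅, empty_subset _, .empty, ?_, ?_⟩
    · have := hw.setIntegral_pos I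
      simp only [measureReal_empty]; positivity
    · have h1 := bracket I hI2
      have h2 := I.len_pos
      simp only [desc, Finset.sum_empty, setIntegral_empty]; positivity
  | succ n ih =>
    have h1 := bracket I hI2
    have h2 := I.len_pos
    have hpos := hw.setIntegral_pos I
    by_cases hhi : lam * m * I.len < ∫ x in I.toSet, w x
    · have hn' : n + 1 < N := hI.resolve_right fun h => absurd hhi (not_lt.2 h.2)
      refine ⟨I.toSet, subset_rfl, I.measurableSet_toSet, ?_, ?_⟩
      · rw [volume_real_toSet, le_div_iff₀ hlm]; linarith
      · have h3 := H _ hn' I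
        have : 0 ≤ K * (m / 4 * I.len) := by positivity
        linarith
    by_cases hlo : ∫ x in I.toSet, w x < m / 4 * I.len
    · have hn' : n + 1 < N := hI.resolve_right fun h => absurd hlo (not_lt.2 h.1)
      refine ⟨∅, empty_subset _, .empty, ?_, ?_⟩
      · simp only [measureReal_empty]; positivity
      · have h3 := H _ hn' I
        have := mul_le_mul_of_nonneg_left hlo.le hK
        simp only [setIntegral_empty]
        linarith
    rw [not_lt] at hhi hlo
    have hadd := isAdditive_setIntegral (fun I => hw.integrableOn_toSet I) I
    beta_reduce at hadd
    have hpl := hw.setIntegral_pos I.left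
    have hpr := hw.setIntegral_pos I.right
    obtain ⟨E, hE, hEm, hEv, hEs⟩ := ih (by lia) I.left (.inl (by lia))
      (by rw [len_left]; linarith)
    obtain ⟨F, hF, hFm, hFv, hFs⟩ := ih (by lia) I.right (.inl (by lia))
      (by rw [len_right]; linarith)
    refine ⟨E ∪ F, union_subset (hE.trans I.left_subset) (hF.trans I.right_subset), hEm.union hFm,
      ?_, ?_⟩
    · refine (measureReal_union_le _ _).trans ?_
      rw [hadd, add_div]
      exact add_le_add hEv hFv
    rw [setIntegral_union (I.disjoint_left_right.mono hE hF) hFm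
      ((hw.integrableOn_toSet _).mono_set hE) ((hw.integrableOn_toSet _).mono_set hF),
      sum_desc_succ]
    -- The lower threshold replaces `1 / w(I)` by `4 / (m |I|)`. Then `(w₋ - w₊)² / |I|` is exactly
    -- the increment of `w(I)² / |I|` on passing to the halves, so the sum telescopes.
    have hvar : relVariation (fun I => ∫ x in I.toSet, w x) I ≤ 4 / m *
        (((∫ x in I.left.toSet, w x) - ∫ x in I.right.toSet, w x) ^ 2 / I.len) := by
      rw [relVariation, div_mul_div_comm, div_le_div_iff₀ hpos (by positivity)]
      nlinarith [sq_nonneg ((∫ x in I.left.toSet, w x) - ∫ x in I.right.toSet, w x)]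
    rw [len_left] at hEs
    rw [len_right] at hFs
    refine (add_le_add hvar (add_le_add hEs hFs)).trans_eq ?_
    rw [hadd]
    field_simp
    ring

/-- An `A_∞` weight satisfies the dyadic Carleson condition for its relative square variation. -/
theorem exists_sum_relVariation_le {w : ℝ → ℝ} (hw : IsWeight w) (hA : IsAInfty w) :
    ∃ K : ℝ, 0 < K ∧ ∀ n J, ∑ L ∈ desc n J, relVariation (fun I => ∫ x in I.toSet, w x) L ≤
      K * ∫ x in J.toSet, w x := by
  obtain ⟨δ, hδ, hE⟩ := hA.exists_setIntegral_le hw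
  obtain ⟨lam, hlam, hlδ⟩ : ∃ lam : ℝ, 1 ≤ lam ∧ 1 / lam ≤ δ :=
    ⟨max 1 (1 / δ), le_max_left _ _, by
      rw [one_div_le (by positivity) hδ]; exact le_max_right _ _⟩
  -- With `K = 64 lam²`, the telescoping part costs `16 lam² = K/4`, the intervals of small average
  -- `K/4`, and those of large average `K/2`; the total is `K`.
  refine ⟨64 * lam ^ 2, by positivity, fun N => ?_⟩
  induction N using Nat.strong_induction_on with
  | _ N H =>
  intro J
  have hl := J.len_pos
  have hpos := hw.setIntegral_pos J
  obtain ⟨m, hm⟩ : ∃ m, m = (∫ x in J.toSet, w x) / J.len := ⟨_, rfl⟩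
  have hm0 : 0 < m := by rw [hm]; positivity
  have hmJ : ∫ x in J.toSet, w x = m * J.len := by rw [hm]; field_simp
  have hml : 0 < m * J.len := by positivity
  obtain ⟨E, hEJ, hEm, hEv, hEs⟩ := exists_stopping_bound hw hm0 hlam
    (show 0 ≤ 64 * lam ^ 2 by positivity) N H N le_rfl J
    (.inr ⟨by rw [hmJ]; linarith, by rw [hmJ]; nlinarith⟩) (by rw [hmJ]; nlinarith)
  -- The large-average intervals have total length at most `|J| / lam ≤ δ |J|`.
  have hhalf := hE J E hEm hEJ (hEv.trans (by
    calc _ = 1 / lam * J.len := by rw [hmJ]; field_simp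
      _ ≤ _ := by gcongr))
  refine hEs.trans ?_
  have h3 := mul_le_mul_of_nonneg_left hhalf (show 0 ≤ 64 * lam ^ 2 by positivity)
  have h4 : 0 ≤ 4 / m * ((∫ x in J.toSet, w x) ^ 2 / J.len) := by positivity
  have h5 : 4 / m * ((2 * lam * m) ^ 2 * J.len) = 16 * lam ^ 2 * (m * J.len) := by
    field_simp; ring
  rw [mul_sub, h5]
  rw [hmJ] at h3 h4 ⊢
  linarith

end DyadicInterval
end HaarTwoWeight

/-! ### The bilinear estimate in unweighted `L²`. -/

namespace HaarTwoWeight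
open DyadicInterval

theorem IsWeight.memLp_sqrt {w : ℝ → ℝ} (hw : IsWeight w) (I : DyadicInterval) :
    MemLp (fun x => √(w x)) 2 (volume.restrict I.toSet) := by
  have hm : AEStronglyMeasurable (fun x => √(w x)) (volume.restrict I.toSet) :=
    Real.continuous_sqrt.comp_aestronglyMeasurable (hw.integrableOn_toSet I).aestronglyMeasurable
  rw [memLp_two_iff_integrable_sq hm]
  refine (hw.integrableOn_toSet I).congr ?_
  filter_upwards [ae_restrict_of_ae hw.pos] with x hx
  exact (Real.sq_sqrt hx.le).symm

variable {v w φ ψ : ℝ → ℝ}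

theorem IsWeight.integrableOn_mul_sqrt (hw : IsWeight w) (hφ : MemLp φ 2) (I : DyadicInterval) :
    IntegrableOn (fun x => φ x * √(w x)) I.toSet :=
  (hφ.restrict _).integrable_mul (hw.memLp_sqrt I)

theorem IsWeight.sq_setIntegral_le (hw : IsWeight w) (hφ : MemLp φ 2) (I : DyadicInterval) :
    (∫ x in I.toSet, φ x * √(w x)) ^ 2 ≤ (∫ x in I.toSet, w x) * ∫ x in I.toSet, φ x ^ 2 := by
  have hi := hw.integrableOn_toSet I
  have hp := hw.setIntegral_pos I
  have hφi : IntegrableOn (fun x => φ x ^ 2) I.toSet := hφ.integrable_sq.integrableOn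
  have hpi := hw.integrableOn_mul_sqrt hφ I
  set p := ∫ x in I.toSet, φ x * √(w x) with hpdef
  set W := ∫ x in I.toSet, w x with hW
  -- Cauchy–Schwarz by projection: `p / W` is the optimal multiple of `√w`.
  have h0 : 0 ≤ ∫ x in I.toSet, (φ x - p / W * √(w x)) ^ 2 := integral_nonneg fun x => sq_nonneg _
  have e : ∫ x in I.toSet, (φ x - p / W * √(w x)) ^ 2 =
      ∫ x in I.toSet, (φ x ^ 2 - (2 * (p / W)) * (φ x * √(w x)) + (p / W) ^ 2 * w x) := by
    apply integral_congr_ae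
    filter_upwards [ae_restrict_of_ae hw.pos] with x hx
    have := Real.sq_sqrt hx.le
    linear_combination (p / W) ^ 2 * this
  have i1 : IntegrableOn (fun x => φ x ^ 2 - 2 * (p / W) * (φ x * √(w x))) I.toSet :=
    hφi.sub (hpi.const_mul _)
  rw [e, integral_add i1 (hi.const_mul _),
    integral_sub hφi (hpi.const_mul _), integral_const_mul, integral_const_mul, ← hpdef, ← hW] at h0
  have e2 : (∫ x in I.toSet, φ x ^ 2) - 2 * (p / W) * p + (p / W) ^ 2 * W =
      (∫ x in I.toSet, φ x ^ 2) - p ^ 2 / W := by field_simp; ring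
  rw [e2, sub_nonneg, div_le_iff₀ hp] at h0
  linarith

/-- The ratio of the averages of `φ √w` and of `w` over `I`. -/
def ratio (φ w : ℝ → ℝ) (I : DyadicInterval) : ℝ :=
  (∫ x in I.toSet, φ x * √(w x)) / ∫ x in I.toSet, w x

theorem IsWeight.avg_pos (hw : IsWeight w) (I : DyadicInterval) : 0 < avg w I := by
  rw [avg_eq]; exact div_pos (hw.setIntegral_pos I) I.len_pos

theorem IsWeight.avg_mul_sqrt (hw : IsWeight w) (I : DyadicInterval) :
    avg (fun x => φ x * √(w x)) I = ratio φ w I * avg w I := by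
  have := hw.setIntegral_pos I
  have := I.len_pos
  rw [avg_eq, avg_eq, ratio]; field_simp

theorem IsWeight.sum_mul_ratio_sq_le (hw : IsWeight w) {a : DyadicInterval → ℝ}
    (ha : ∀ I, 0 ≤ a I) {C : ℝ} (hC : 0 < C)
    (h : ∀ n J, ∑ I ∈ desc n J, a I ≤ C * ∫ x in J.toSet, w x) (hφ : MemLp φ 2)
    (s : Finset DyadicInterval) : ∑ I ∈ s, a I * ratio φ w I ^ 2 ≤ 4 * C * ∫ x, φ x ^ 2 := by
  refine sum_le_integral (fun I => mul_nonneg (ha I) (sq_nonneg _)) hφ.integrable_sq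
    (fun x => sq_nonneg _) (by positivity) ?_ s
  exact carleson_embedding (isAdditive_setIntegral fun I => hw.integrableOn_toSet I)
    hw.setIntegral_pos (isAdditive_setIntegral fun I => hw.integrableOn_mul_sqrt hφ I)
    (isAdditive_setIntegral fun I => hφ.integrable_sq.integrableOn) (hw.sq_setIntegral_le hφ) ha hC h

theorem SquareTesting.exists_sum_le (hv : IsWeight v) (hw : IsWeight w) (h : SquareTesting w v) :
    ∃ C : ℝ, 0 < C ∧ ∀ n J, ∑ I ∈ desc n J, |diff w I| ^ 2 * avg v I * I.len ≤
      C * ∫ x in J.toSet, w x := by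
  classical
  obtain ⟨C, hC⟩ := h
  have h0 : ∀ I : DyadicInterval, 0 ≤ |diff w I| ^ 2 * avg v I * I.len := fun I => by
    have := hv.avg_pos I
    have := I.len_pos
    positivity
  refine ⟨max C 1, by positivity, fun n J => ?_⟩
  have hl := J.len_pos
  have hsum : ENNReal.ofReal (∑ I ∈ desc n J, |diff w I| ^ 2 * avg v I * I.len) ≤
      ∑' I : {I : DyadicInterval // I.toSet ⊆ J.toSet},
        ENNReal.ofReal (|diff w I.1| ^ 2 * avg v I.1 * I.1.len) := by
    rw [ENNReal.ofReal_sum_of_nonneg fun I _ => h0 I]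
    have := ENNReal.sum_le_tsum (f := fun I : {I : DyadicInterval // I.toSet ⊆ J.toSet} =>
      ENNReal.ofReal (|diff w I.1| ^ 2 * avg v I.1 * I.1.len))
      ((desc n J).subtype fun I => I.toSet ⊆ J.toSet)
    refine le_trans (le_of_eq ?_) this
    rw [Finset.sum_subtype_of_mem (fun I => ENNReal.ofReal (|diff w I| ^ 2 * avg v I * I.len))
      fun I hI => subset_of_mem_desc hI]
  have key := (mul_le_mul_right hsum (ENNReal.ofReal (1 / J.len))).trans (hC J)
  have hp := hw.avg_pos J
  have hCm : C * avg w J ≤ max C 1 * avg w J := by gcongr; exact le_max_left _ _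
  rw [← ENNReal.ofReal_mul (by positivity)] at key
  have key2 := (ENNReal.ofReal_le_ofReal_iff (by positivity)).1
    (key.trans (ENNReal.ofReal_le_ofReal hCm))
  rw [avg_eq, one_div, inv_mul_le_iff₀ hl] at key2
  refine key2.trans_eq ?_
  field_simp

theorem sq_diff_mul_len_div_avg (w : ℝ → ℝ) (I : DyadicInterval) :
    |diff w I| ^ 2 * I.len / avg w I = 4 * relVariation (fun I => ∫ x in I.toSet, w x) I := by
  have := I.len_pos
  rw [sq_abs, DyadicInterval.diff_eq, avg_eq, relVariation]
  field_simp
  ring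

theorem sum_mul_le_of_sum_sq_le {ι : Type*} {s : Finset ι} {f g : ι → ℝ} {A B X Y : ℝ}
    (hA : 0 ≤ A) (hB : 0 ≤ B) (hf : ∑ i ∈ s, f i ^ 2 ≤ A * X) (hg : ∑ i ∈ s, g i ^ 2 ≤ B * Y) :
    ∑ i ∈ s, f i * g i ≤ √A * √B * (√X * √Y) := by
  refine (Real.sum_mul_le_sqrt_mul_sqrt s f g).trans ?_
  calc _ ≤ √(A * X) * √(B * Y) := by gcongr
    _ = _ := by rw [Real.sqrt_mul hA, Real.sqrt_mul hB]; ring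

/-- One term of the bilinear sum, with the averages normalised by those of the weights. -/
theorem bilinear_term_eq (hv : IsWeight v) (hw : IsWeight w) (I : DyadicInterval) :
    |avg (fun x => ψ x * √(v x)) I| * |avg (fun x => φ x * √(w x)) I| * alpha v w I =
      |ratio ψ v I| * |ratio φ w I| * (|diff v I| * |diff w I| * I.len) := by
  have h1 := hv.avg_pos I
  have h2 := hw.avg_pos I
  rw [hv.avg_mul_sqrt, hw.avg_mul_sqrt, alpha, abs_mul, abs_mul, abs_div, abs_div, abs_of_pos h1,
    abs_of_pos h2]
  field_simp

/-- Cauchy–Schwarz after writing `|I| = √(⟨w⟩_I |I|) √(|I| / ⟨w⟩_I)`: square testing packs the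
factor with `diff v`, and `A_∞` packs the factor with `diff w`. -/
theorem exists_bilinear_le_of_isAInfty_right (hv : IsWeight v) (hw : IsWeight w)
    (h13 : SquareTesting v w) (hA : IsAInfty w) :
    ∃ C : ℝ, 0 ≤ C ∧ ∀ φ ψ : ℝ → ℝ, MemLp φ 2 → MemLp ψ 2 → ∀ s : Finset DyadicInterval,
      ∑ I ∈ s, |ratio ψ v I| * |ratio φ w I| * (|diff v I| * |diff w I| * I.len) ≤
        C * (√(∫ x, ψ x ^ 2) * √(∫ x, φ x ^ 2)) := by
  obtain ⟨C, hC, h⟩ := h13.exists_sum_le hw hv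
  obtain ⟨K, hK, hKs⟩ := exists_sum_relVariation_le hw hA
  refine ⟨√(4 * C) * √(4 * (4 * K)), by positivity, fun φ ψ hφ hψ s => ?_⟩
  have h1 := hv.sum_mul_ratio_sq_le (fun I => by
    have := hw.avg_pos I
    have := I.len_pos
    positivity) hC h hψ s
  have h2 := hw.sum_mul_ratio_sq_le (a := fun I => |diff w I| ^ 2 * I.len / avg w I) (fun I => by
    have := hw.avg_pos I
    have := I.len_pos
    positivity) (C := 4 * K) (by positivity) (fun n J => by
    simp only [sq_diff_mul_len_div_avg]
    rw [← Finset.mul_sum, mul_assoc]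
    exact mul_le_mul_of_nonneg_left (hKs n J) (by norm_num)) hφ s
  refine le_trans (le_of_eq ?_) (sum_mul_le_of_sum_sq_le (s := s)
    (f := fun I => |diff v I| * √(avg w I * I.len) * |ratio ψ v I|)
    (g := fun I => |diff w I| * √(I.len / avg w I) * |ratio φ w I|)
    (by positivity) (by positivity) (le_trans (le_of_eq ?_) h1) (le_trans (le_of_eq ?_) h2))
  · refine Finset.sum_congr rfl fun I _ => ?_
    have h1 := hw.avg_pos I
    have h2 := I.len_pos
    have : √(avg w I * I.len) * √(I.len / avg w I) = I.len := by
      rw [← Real.sqrt_mul (by positivity), show avg w I * I.len * (I.len / avg w I) = I.len ^ 2 by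
        field_simp, Real.sqrt_sq h2.le]
    linear_combination -|ratio ψ v I| * |ratio φ w I| * (|diff v I| * |diff w I|) * this
  · refine Finset.sum_congr rfl fun I _ => ?_
    have h1 := hw.avg_pos I
    have h2 := I.len_pos
    rw [mul_pow, mul_pow, Real.sq_sqrt (by positivity), sq_abs (ratio _ _ _)]; ring
  · refine Finset.sum_congr rfl fun I _ => ?_
    have h1 := hw.avg_pos I
    have h2 := I.len_pos
    rw [mul_pow, mul_pow, Real.sq_sqrt (by positivity), sq_abs (ratio _ _ _)]; ring

theorem exists_bilinear_le (hv : IsWeight v) (hw : IsWeight w) (h12 : SquareTesting w v)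
    (h13 : SquareTesting v w) (hA : IsAInfty v ∨ IsAInfty w) :
    ∃ C : ℝ, 0 ≤ C ∧ ∀ φ ψ : ℝ → ℝ, MemLp φ 2 → MemLp ψ 2 → ∀ s : Finset DyadicInterval,
      ∑ I ∈ s, |ratio ψ v I| * |ratio φ w I| * (|diff v I| * |diff w I| * I.len) ≤
        C * (√(∫ x, ψ x ^ 2) * √(∫ x, φ x ^ 2)) := by
  rcases hA with hA | hA
  · obtain ⟨C, hC, h⟩ := exists_bilinear_le_of_isAInfty_right hw hv h12 hA
    refine ⟨C, hC, fun φ ψ hφ hψ s => ?_⟩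
    convert h ψ φ hψ hφ s using 2
    · ring
    · ring
  · exact exists_bilinear_le_of_isAInfty_right hv hw h13 hA

/-! ### The bilinear estimate for Haar coefficients. -/

theorem integral_mul_haar {u : ℝ → ℝ} {I : DyadicInterval} (hu : IntegrableOn u I.toSet) :
    ∫ x, u x * I.haar x =
      (√I.len)⁻¹ * ((∫ x in I.left.toSet, u x) - ∫ x in I.right.toSet, u x) := by
  have hl := (integrable_indicator_iff I.left.measurableSet_toSet).2 (hu.mono_set I.left_subset)
  have hr := (integrable_indicator_iff I.right.measurableSet_toSet).2 (hu.mono_set I.right_subset)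
  rw [← integral_indicator I.left.measurableSet_toSet,
    ← integral_indicator I.right.measurableSet_toSet, ← integral_sub hl hr, ← integral_const_mul]
  congr 1
  ext x
  simp only [haar, chi, indicator]
  split_ifs <;> ring

/-- A Haar coefficient splits into its `w`-adapted part and an averaging part. -/
theorem abs_integral_mul_haar_le (hw : IsWeight w) (hφ : MemLp φ 2) (I : DyadicInterval) :
    |∫ x, φ x * √(w x) * I.haar x| ≤
      √(avg w I) * √(haarEnergy (fun I => ∫ x in I.toSet, w x)
        (fun I => ∫ x in I.toSet, φ x * √(w x)) I) +
      √I.len * |ratio φ w I| * |diff w I| / 2 := by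
  have hl := I.len_pos
  have hs : 0 < √I.len := Real.sqrt_pos.2 hl
  have ha := hw.avg_pos I
  have hwadd := isAdditive_setIntegral fun I => hw.integrableOn_toSet I
  have hpadd := isAdditive_setIntegral fun I => hw.integrableOn_mul_sqrt hφ I
  have key := abs_sub_le_sqrt_haarEnergy hwadd hw.setIntegral_pos hpadd I
  rw [integral_mul_haar (hw.integrableOn_mul_sqrt hφ I), abs_mul, abs_of_pos (inv_pos.2 hs),
    inv_mul_le_iff₀ hs]
  refine key.trans_eq ?_
  have e1 : ∫ x in I.toSet, w x = avg w I * I.len := by rw [avg_eq]; field_simp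
  have e2 : (∫ x in I.left.toSet, w x) - ∫ x in I.right.toSet, w x = diff w I * (I.len / 2) := by
    rw [DyadicInterval.diff_eq]; field_simp
  have e3 : √I.len * √I.len = I.len := Real.mul_self_sqrt hl.le
  rw [e2, Real.sqrt_mul (hw.setIntegral_pos I).le, e1, Real.sqrt_mul ha.le, abs_mul,
    abs_of_pos (show 0 < I.len / 2 by positivity), ← e1, ← ratio]
  linear_combination (-|ratio φ w I| * |diff w I| / 2) * e3

theorem sum_haarEnergy_le_integral (hw : IsWeight w) (hφ : MemLp φ 2) (s : Finset DyadicInterval) :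
    ∑ I ∈ s, haarEnergy (fun I => ∫ x in I.toSet, w x)
      (fun I => ∫ x in I.toSet, φ x * √(w x)) I ≤ 1 * ∫ x, φ x ^ 2 := by
  have hwadd := isAdditive_setIntegral fun I => hw.integrableOn_toSet I
  have hpadd := isAdditive_setIntegral fun I => hw.integrableOn_mul_sqrt hφ I
  refine sum_le_integral (haarEnergy_nonneg hwadd hw.setIntegral_pos hpadd) hφ.integrable_sq
    (fun x => sq_nonneg _) zero_le_one (fun n J => ?_) s
  rw [one_mul]
  exact sum_haarEnergy_le hw.setIntegral_pos
    (isAdditive_setIntegral fun I => hφ.integrable_sq.integrableOn) (hw.sq_setIntegral_le hφ) n J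

/-- Controls the averaging part of one Haar coefficient when it meets the adapted part of the other.
-/
theorem SquareTesting.exists_sum_sq_le (hv : IsWeight v) (hw : IsWeight w)
    (h : SquareTesting w v) : ∃ C : ℝ, 0 < C ∧ ∀ φ : ℝ → ℝ, MemLp φ 2 →
      ∀ s : Finset DyadicInterval,
      ∑ I ∈ s, (√(avg v I) * √I.len * |ratio φ w I| * |diff w I|) ^ 2 ≤ C * ∫ x, φ x ^ 2 := by
  obtain ⟨C, hC, h⟩ := h.exists_sum_le hv hw
  refine ⟨4 * C, by positivity, fun φ hφ s => ?_⟩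
  refine le_trans (le_of_eq ?_) (hw.sum_mul_ratio_sq_le (fun I => by
    have := hv.avg_pos I
    have := I.len_pos
    positivity) hC h hφ s)
  refine Finset.sum_congr rfl fun I _ => ?_
  rw [mul_pow, mul_pow, mul_pow, Real.sq_sqrt (hv.avg_pos I).le, Real.sq_sqrt I.len_pos.le,
    sq_abs (ratio _ _ _)]
  ring

theorem exists_haar_bilinear_le (hv : IsWeight v) (hw : IsWeight w) (h12 : SquareTesting w v)
    (h13 : SquareTesting v w) (hA : IsAInfty v ∨ IsAInfty w) (h11 : JointA2 v w) :
    ∃ C : ℝ, 0 ≤ C ∧ ∀ φ ψ : ℝ → ℝ, MemLp φ 2 → MemLp ψ 2 → ∀ s : Finset DyadicInterval,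
      ∑ I ∈ s, |∫ x, ψ x * √(v x) * I.haar x| * |∫ x, φ x * √(w x) * I.haar x| ≤
        C * (√(∫ x, ψ x ^ 2) * √(∫ x, φ x ^ 2)) := by
  obtain ⟨A, hA2⟩ := h11
  obtain ⟨B, hB, hBs⟩ := exists_bilinear_le hv hw h12 h13 hA
  obtain ⟨C, hC, hCs⟩ := h12.exists_sum_sq_le hv hw
  obtain ⟨D, hD, hDs⟩ := h13.exists_sum_sq_le hw hv
  -- One summand per product of parts; each `√1` is a Bessel constant, each 2 comes from an
  -- averaging part.
  refine ⟨√A * (√1 * √1) + √1 * √C / 2 + √D * √1 / 2 + B / 4, by positivity,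
    fun φ ψ hφ hψ s => ?_⟩
  set X := fun I => √(haarEnergy (fun I => ∫ x in I.toSet, w x)
        (fun I => ∫ x in I.toSet, φ x * √(w x)) I) with hX
  set Y := fun I => √(haarEnergy (fun I => ∫ x in I.toSet, v x)
        (fun I => ∫ x in I.toSet, ψ x * √(v x)) I) with hY
  have hXs : ∑ I ∈ s, X I ^ 2 ≤ 1 * ∫ x, φ x ^ 2 := by
    refine le_trans (le_of_eq (Finset.sum_congr rfl fun I _ => ?_))
      (sum_haarEnergy_le_integral hw hφ s)
    exact Real.sq_sqrt (haarEnergy_nonneg (isAdditive_setIntegral fun I => hw.integrableOn_toSet I)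
      hw.setIntegral_pos (isAdditive_setIntegral fun I => hw.integrableOn_mul_sqrt hφ I) I)
  have hYs : ∑ I ∈ s, Y I ^ 2 ≤ 1 * ∫ x, ψ x ^ 2 := by
    refine le_trans (le_of_eq (Finset.sum_congr rfl fun I _ => ?_))
      (sum_haarEnergy_le_integral hv hψ s)
    exact Real.sq_sqrt (haarEnergy_nonneg (isAdditive_setIntegral fun I => hv.integrableOn_toSet I)
      hv.setIntegral_pos (isAdditive_setIntegral fun I => hv.integrableOn_mul_sqrt hψ I) I)
  have t1 := sum_mul_le_of_sum_sq_le zero_le_one zero_le_one hYs hXs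
  have t2 := sum_mul_le_of_sum_sq_le zero_le_one hC.le hYs (hCs φ hφ s)
  have t3 := sum_mul_le_of_sum_sq_le hD.le zero_le_one (hDs ψ hψ s) hXs
  have t4 := hBs φ ψ hφ hψ s
  have t1' := mul_le_mul_of_nonneg_left t1 (Real.sqrt_nonneg A)
  calc _ ≤ ∑ I ∈ s, (√A * (Y I * X I) +
        Y I * (√(avg v I) * √I.len * |ratio φ w I| * |diff w I|) / 2 +
        (√(avg w I) * √I.len * |ratio ψ v I| * |diff v I|) * X I / 2 +
        |ratio ψ v I| * |ratio φ w I| * (|diff v I| * |diff w I| * I.len) / 4) := by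
        refine Finset.sum_le_sum fun I _ => ?_
        refine (mul_le_mul (abs_integral_mul_haar_le hv hψ I) (abs_integral_mul_haar_le hw hφ I)
          (abs_nonneg _) (by positivity)).trans ?_
        have e3 : √I.len * √I.len = I.len := Real.mul_self_sqrt I.len_pos.le
        have e4 : √(avg v I) * √(avg w I) ≤ √A := by
          rw [← Real.sqrt_mul (hv.avg_pos I).le]; exact Real.sqrt_le_sqrt (hA2 I)
        have e5 : √(avg v I) * √(avg w I) * (Y I * X I) ≤ √A * (Y I * X I) := by
          gcongr
        refine le_trans (le_of_eq ?_) (add_le_add_left (add_le_add_left (add_le_add_left e5 _) _) _)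
        simp only [hX, hY]
        linear_combination (|ratio ψ v I| * |ratio φ w I| * (|diff v I| * |diff w I|) / 4) * e3
    _ ≤ _ := by
        rw [Finset.sum_add_distrib, Finset.sum_add_distrib, Finset.sum_add_distrib,
          ← Finset.mul_sum, ← Finset.sum_div, ← Finset.sum_div, ← Finset.sum_div]
        linear_combination t1' + t2 / 2 + t3 / 2 + t4 / 4

end HaarTwoWeight

/-! ### Unconditional convergence in Hilbert space. -/

namespace HaarTwoWeight
open DyadicInterval
open scoped InnerProductSpace

section Hilbert

variable {ι H H' : Type*} [NormedAddCommGroup H] [InnerProductSpace ℝ H]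
  [NormedAddCommGroup H'] [InnerProductSpace ℝ H']

theorem exists_sign_sq_norm_add_le (a b : H) :
    ∃ τ : ℝ, (τ = 1 ∨ τ = -1) ∧ ‖a‖ ^ 2 + ‖b‖ ^ 2 ≤ ‖a + τ • b‖ ^ 2 := by
  rcases le_total 0 ⟪a, b⟫_ℝ with h | h
  · refine ⟨1, .inl rfl, ?_⟩
    rw [one_smul, norm_add_sq_real]; linarith
  · refine ⟨-1, .inr rfl, ?_⟩
    rw [neg_one_smul, ← sub_eq_add_neg, norm_sub_sq_real]; linarith

/-- Test the signed sum against itself. -/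
theorem norm_sum_le_of_sum_abs_inner_le {x : ι → H} {M : ℝ} (hM : 0 ≤ M) {s : Finset ι}
    (h : ∀ G : H, ∑ i ∈ s, |⟪x i, G⟫_ℝ| ≤ M * ‖G‖) {σ : ι → ℝ} (hσ : ∀ i, |σ i| ≤ 1) :
    ‖∑ i ∈ s, σ i • x i‖ ≤ M := by
  set y := ∑ i ∈ s, σ i • x i with hy
  have key : ‖y‖ * ‖y‖ ≤ M * ‖y‖ := by
    calc ‖y‖ * ‖y‖ = ⟪y, y⟫_ℝ := (real_inner_self_eq_norm_mul_norm y).symm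
      _ = ∑ i ∈ s, σ i * ⟪x i, y⟫_ℝ := by
        conv_lhs => rw [hy]
        rw [sum_inner, ← hy]
        simp [real_inner_smul_left]
      _ ≤ ∑ i ∈ s, |⟪x i, y⟫_ℝ| := by
        refine Finset.sum_le_sum fun i _ => (le_abs_self _).trans ?_
        rw [abs_mul]
        exact mul_le_of_le_one_left (abs_nonneg _) (hσ i)
      _ ≤ _ := h y
  rcases (norm_nonneg y).eq_or_lt with h0 | h0
  · rw [← h0]; exact hM
  · exact le_of_mul_le_mul_right key h0

/-- In a Hilbert space a weakly unconditionally bounded series converges unconditionally. -/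
theorem summable_of_sum_abs_inner_le [CompleteSpace H] {x : ι → H} {M : ℝ} (hM : 0 ≤ M)
    (h : ∀ (s : Finset ι) (G : H), ∑ i ∈ s, |⟪x i, G⟫_ℝ| ≤ M * ‖G‖) : Summable x := by
  classical
  rw [summable_iff_vanishing_norm]
  by_contra! hcon
  obtain ⟨ε, hε, hcon⟩ := hcon
  -- If the Cauchy criterion fails, there are always further disjoint blocks of norm at least `ε`. A
  -- sign making the cross term nonnegative lets each add `ε²`, until the uniform bound `M²` is
  -- exceeded.
  have grow : ∀ n : ℕ, ∃ (t : Finset ι) (σ : ι → ℝ), (∀ i, |σ i| ≤ 1) ∧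
      n * ε ^ 2 ≤ ‖∑ i ∈ t, σ i • x i‖ ^ 2 := by
    intro n
    induction n with
    | zero => exact ⟨∅, fun _ => 1, by simp, by simp⟩
    | succ n ih =>
      obtain ⟨t, σ, hσ, ht⟩ := ih
      obtain ⟨u, hut, hu⟩ := hcon t
      obtain ⟨τ, hτ, hb⟩ := exists_sign_sq_norm_add_le (∑ i ∈ t, σ i • x i) (∑ i ∈ u, x i)
      refine ⟨t ∪ u, fun i => if i ∈ t then σ i else τ, fun i => ?_, ?_⟩
      · dsimp only
        split_ifs
        · exact hσ i
        · rcases hτ with rfl | rfl <;> simp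
      · rw [Finset.sum_union hut.symm]
        have e1 : ∑ i ∈ t, (if i ∈ t then σ i else τ) • x i = ∑ i ∈ t, σ i • x i :=
          Finset.sum_congr rfl fun i hi => by rw [if_pos hi]
        have e2 : ∑ i ∈ u, (if i ∈ t then σ i else τ) • x i = τ • ∑ i ∈ u, x i := by
          rw [Finset.smul_sum]
          exact Finset.sum_congr rfl fun i hi => by rw [if_neg (Finset.disjoint_left.1 hut hi)]
        rw [e1, e2]
        have : ε ^ 2 ≤ ‖∑ i ∈ u, x i‖ ^ 2 := by gcongr
        push_cast
        linarith
  obtain ⟨n, hn⟩ := exists_nat_gt (M ^ 2 / ε ^ 2)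
  obtain ⟨t, σ, hσ, ht⟩ := grow n
  have h1 : ‖∑ i ∈ t, σ i • x i‖ ^ 2 ≤ M ^ 2 := by
    gcongr
    exact norm_sum_le_of_sum_abs_inner_le hM (h t) hσ
  rw [div_lt_iff₀ (by positivity)] at hn
  linarith

/-- Linear functionals `c i` and vectors `x i` satisfying an absolute bilinear estimate define a
bounded operator `∑ i, c i ⊗ x i`, the series converging unconditionally. -/
theorem exists_clm_hasSum [CompleteSpace H] (c : ι → H' →ₗ[ℝ] ℝ) (x : ι → H) {M : ℝ} (hM : 0 ≤ M)
    (h : ∀ (s : Finset ι) (f : H') (G : H), ∑ i ∈ s, |c i f| * |⟪x i, G⟫_ℝ| ≤ M * (‖G‖ * ‖f‖)) :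
    ∃ T : H' →L[ℝ] H, ‖T‖ ≤ M ∧ ∀ f, HasSum (fun i => c i f • x i) (T f) := by
  have h' : ∀ (f : H') (s : Finset ι) (G : H),
      ∑ i ∈ s, |⟪c i f • x i, G⟫_ℝ| ≤ (M * ‖f‖) * ‖G‖ := by
    intro f s G
    simp only [real_inner_smul_left, abs_mul]
    refine (h s f G).trans_eq (by ring)
  have hsum : ∀ f, Summable fun i => c i f • x i := fun f =>
    summable_of_sum_abs_inner_le (by positivity) (h' f)
  let T₀ : H' →ₗ[ℝ] H :=
    { toFun := fun f => ∑' i, c i f • x i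
      map_add' := fun f g => by
        rw [← (hsum f).tsum_add (hsum g)]
        simp only [map_add, add_smul]
      map_smul' := fun r f => by
        rw [RingHom.id_apply, ← (hsum f).tsum_const_smul]
        simp only [map_smul, smul_assoc] }
  have hT : ∀ f, ‖T₀ f‖ ≤ M * ‖f‖ := fun f =>
    le_of_tendsto (hsum f).hasSum.norm (.of_forall fun s => by
      simpa using norm_sum_le_of_sum_abs_inner_le (σ := fun _ => 1) (by positivity) (h' f s)
        (by simp))
  exact ⟨T₀.mkContinuous M hT, T₀.mkContinuous_norm_le hM hT, fun f => (hsum f).hasSum⟩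

end Hilbert

/-! ### Transfer to weighted spaces and conclusion. -/

section WeightedL2

variable {u : ℝ → ℝ}

/-- Lets identities between classes in `L2 u` be used Lebesgue almost everywhere. -/
theorem absolutelyContinuous_wMeasure (hu : AEMeasurable u) (hu0 : ∀ᵐ x, 0 < u x) :
    volume ≪ wMeasure u :=
  withDensity_absolutelyContinuous' hu.ennreal_ofReal (by
    filter_upwards [hu0] with x hx using (ENNReal.ofReal_pos.2 hx).ne')

theorem integral_wMeasure (hu : AEMeasurable u) (hu0 : ∀ᵐ x, 0 < u x) (k : ℝ → ℝ) :
    ∫ x, k x ∂wMeasure u = ∫ x, u x * k x := by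
  rw [wMeasure, integral_withDensity_eq_integral_toReal_smul₀ hu.ennreal_ofReal (by simp)]
  apply integral_congr_ae
  filter_upwards [hu0] with x hx
  rw [ENNReal.toReal_ofReal hx.le, smul_eq_mul]

theorem memLp_mul_sqrt (hu : AEMeasurable u) (hu0 : ∀ᵐ x, 0 < u x) (f : L2 u) :
    MemLp (fun x => f x * √(u x)) 2 := by
  have hm : AEStronglyMeasurable f volume :=
    (Lp.aestronglyMeasurable f).mono_ac (absolutelyContinuous_wMeasure hu hu0)
  have hs : AEStronglyMeasurable (fun x => √(u x)) volume :=
    Real.continuous_sqrt.comp_aestronglyMeasurable hu.aestronglyMeasurable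
  have hms : AEStronglyMeasurable (fun x => f x * √(u x)) volume := hm.mul hs
  rw [memLp_two_iff_integrable_sq hms]
  have h1 : Integrable (fun x => f x ^ 2) (volume.withDensity fun x => ENNReal.ofReal (u x)) :=
    (Lp.memLp f).integrable_sq
  rw [integrable_withDensity_iff_integrable_smul₀' hu.ennreal_ofReal (by simp)] at h1
  refine h1.congr ?_
  filter_upwards [hu0] with x hx
  rw [ENNReal.toReal_ofReal hx.le, smul_eq_mul, mul_pow, Real.sq_sqrt hx.le, mul_comm]

theorem norm_eq_sqrt_integral (hu : AEMeasurable u) (hu0 : ∀ᵐ x, 0 < u x) (f : L2 u) :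
    ‖f‖ = √(∫ x, (f x * √(u x)) ^ 2) := by
  rw [norm_eq_sqrt_real_inner, L2.inner_def, integral_wMeasure hu hu0]
  congr 1
  apply integral_congr_ae
  filter_upwards [hu0] with x hx
  rw [mul_pow, Real.sq_sqrt hx.le]
  simp only [RCLike.inner_apply, conj_trivial]
  ring

end WeightedL2

variable {v w : ℝ → ℝ}

theorem IsWeight.aemeasurable (hw : IsWeight w) : AEMeasurable w :=
  hw.locallyIntegrable.aestronglyMeasurable.aemeasurable

theorem IsWeight.inv_pos (hw : IsWeight w) : ∀ᵐ x, 0 < (w x)⁻¹ := by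
  filter_upwards [hw.pos] with x hx using _root_.inv_pos.2 hx

/-- The weight is kept as `√v * √v` so that `G √v` appears as the unweighted function `ψ`. -/
theorem IsWeight.inner_toLp (hv : IsWeight v) {k : ℝ → ℝ} (hk : MemLp k 2 (wMeasure v))
    (G : L2 v) : ⟪hk.toLp k, G⟫_ℝ = ∫ x, G x * √(v x) * √(v x) * k x := by
  have e : ⟪hk.toLp k, G⟫_ℝ = ∫ x, k x * G x ∂wMeasure v := by
    rw [L2.inner_def]
    apply integral_congr_ae
    filter_upwards [hk.coeFn_toLp] with x hx
    rw [hx]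
    simp only [RCLike.inner_apply, conj_trivial]
    ring
  rw [e, integral_wMeasure hv.aemeasurable hv.pos]
  apply integral_congr_ae
  filter_upwards [hv.pos] with x hx
  rw [mul_assoc (G x), Real.mul_self_sqrt hx.le]
  ring

theorem IsWeight.mul_sqrt_inv_mul_sqrt (hw : IsWeight w) (f : ℝ → ℝ) :
    (fun x => f x * √((w x)⁻¹) * √(w x)) =ᵐ[volume] f := by
  filter_upwards [hw.pos] with x hx
  have := (Real.sqrt_pos.2 hx).ne'
  rw [Real.sqrt_inv, mul_assoc, inv_mul_cancel₀ this, mul_one]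

theorem IsWeight.memLp_mul_sqrt_inv (hw : IsWeight w) (f : L2 fun x => (w x)⁻¹) :
    MemLp (fun x => f x * √((w x)⁻¹)) 2 :=
  memLp_mul_sqrt hw.aemeasurable.inv hw.inv_pos f

theorem IsWeight.integrableOn_L2 (hw : IsWeight w) (f : L2 fun x => (w x)⁻¹)
    (I : DyadicInterval) : IntegrableOn f I.toSet :=
  (hw.integrableOn_mul_sqrt (hw.memLp_mul_sqrt_inv f) I).congr_fun_ae
    (ae_restrict_of_ae (hw.mul_sqrt_inv_mul_sqrt f))

/-- Integration over `I`, as a linear functional on `L²(w⁻¹)`. -/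
def IsWeight.integralOn (hw : IsWeight w) (I : DyadicInterval) :
    (L2 fun x => (w x)⁻¹) →ₗ[ℝ] ℝ where
  toFun f := ∫ x in I.toSet, f x
  map_add' f g := by
    rw [← integral_add (hw.integrableOn_L2 f I) (hw.integrableOn_L2 g I)]
    apply integral_congr_ae
    apply ae_restrict_of_ae
    filter_upwards [(absolutelyContinuous_wMeasure hw.aemeasurable.inv hw.inv_pos).ae_le
      (Lp.coeFn_add f g)] with x hx using hx
  map_smul' r f := by
    rw [RingHom.id_apply, smul_eq_mul, ← integral_const_mul]
    apply integral_congr_ae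
    apply ae_restrict_of_ae
    filter_upwards [(absolutelyContinuous_wMeasure hw.aemeasurable.inv hw.inv_pos).ae_le
      (Lp.coeFn_smul r f)] with x hx using hx

/-- The Haar coefficient at `I`, as a linear functional on `L²(w⁻¹)`. -/
def IsWeight.haarCoeff (hw : IsWeight w) (I : DyadicInterval) :
    (L2 fun x => (w x)⁻¹) →ₗ[ℝ] ℝ :=
  (√I.len)⁻¹ • (hw.integralOn I.left - hw.integralOn I.right)

theorem IsWeight.haarCoeff_apply (hw : IsWeight w) (I : DyadicInterval)
    (f : L2 fun x => (w x)⁻¹) : hw.haarCoeff I f = ∫ x, f x * I.haar x :=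
  (integral_mul_haar (hw.integrableOn_L2 f I)).symm

theorem integral_mul_chi (u : ℝ → ℝ) (I : DyadicInterval) :
    ∫ x, u x * I.chi x = ∫ x in I.toSet, u x := by
  rw [← integral_indicator I.measurableSet_toSet]
  congr 1
  ext x
  simp only [chi, indicator]
  split_ifs <;> simp

theorem eLpNorm_two_eq_sqrt {φ : ℝ → ℝ} (hφ : MemLp φ 2) :
    eLpNorm φ 2 volume = ENNReal.ofReal (√(∫ x, φ x ^ 2)) := by
  rw [hφ.eLpNorm_eq_integral_rpow_norm (by simp) (by simp), Real.sqrt_eq_rpow]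
  simp

theorem bilinearEstimate (hv : IsWeight v) (hw : IsWeight w) (h12 : SquareTesting w v)
    (h13 : SquareTesting v w) (hA : IsAInfty v ∨ IsAInfty w) : BilinearEstimate v w := by
  obtain ⟨C, hC, h⟩ := exists_bilinear_le hv hw h12 h13 hA
  refine ⟨C, fun f g hf hg => ?_⟩
  rw [eLpNorm_two_eq_sqrt hf, eLpNorm_two_eq_sqrt hg, ← ENNReal.ofReal_mul hC,
    ← ENNReal.ofReal_mul (by positivity), ENNReal.tsum_eq_iSup_sum]
  refine iSup_le fun s => ?_
  simp only [bilinear_term_eq hv hw]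
  rw [← ENNReal.ofReal_sum_of_nonneg fun I _ => by have := I.len_pos; positivity]
  apply ENNReal.ofReal_le_ofReal
  refine (h f g hf hg s).trans_eq (by ring)

theorem t0Bounded (hv : IsWeight v) (hw : IsWeight w) (h12 : SquareTesting w v)
    (h13 : SquareTesting v w) (hA : IsAInfty v ∨ IsAInfty w) : T0Bounded v w hv := by
  obtain ⟨C, hC, h⟩ := exists_bilinear_le hv hw h12 h13 hA
  obtain ⟨T, -, hT⟩ := exists_clm_hasSum
    -- One factor `1 / I.len` turns the integral of `f` into an average; the other, present in the
    -- series, averages the function paired with `chi`.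
    (fun I => (1 / I.len * (1 / I.len) * alpha v w I) • hw.integralOn I)
    (fun I => (memLp_chi hv I).toLp I.chi) hC fun s f G => by
      rw [norm_eq_sqrt_integral hv.aemeasurable hv.pos G,
        norm_eq_sqrt_integral hw.aemeasurable.inv hw.inv_pos f]
      refine le_trans (le_of_eq (Finset.sum_congr rfl fun I _ => ?_))
        (h _ _ (hw.memLp_mul_sqrt_inv f) (memLp_mul_sqrt hv.aemeasurable hv.pos G) s)
      have hl := I.len_pos
      have hα : 0 ≤ alpha v w I := by rw [alpha]; positivity
      rw [← bilinear_term_eq hv hw, hv.inner_toLp, integral_mul_chi, avg_eq, avg_eq,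
        integral_congr_ae (ae_restrict_of_ae (hw.mul_sqrt_inv_mul_sqrt f)), LinearMap.smul_apply,
        smul_eq_mul, abs_mul, abs_of_nonneg (show 0 ≤ 1 / I.len * (1 / I.len) * alpha v w I by
          positivity), abs_div, abs_div, abs_of_pos hl, IsWeight.integralOn, LinearMap.coe_mk,
        AddHom.coe_mk]
      field_simp
  refine ⟨T, fun f => ?_⟩
  convert hT f using 3 with I
  rw [LinearMap.smul_apply, smul_eq_mul, avg_eq]
  change _ = _ * ∫ x in I.toSet, f x
  ring

theorem haarMultipliersUniformlyBounded (hv : IsWeight v) (hw : IsWeight w)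
    (h12 : SquareTesting w v) (h13 : SquareTesting v w) (hA : IsAInfty v ∨ IsAInfty w)
    (h11 : JointA2 v w) : HaarMultipliersUniformlyBounded v w hv := by
  obtain ⟨C, hC, h⟩ := exists_haar_bilinear_le hv hw h12 h13 hA h11
  refine ⟨C, fun σ hσ => ?_⟩
  obtain ⟨T, hTC, hT⟩ := exists_clm_hasSum (fun I => σ I • hw.haarCoeff I)
    (fun I => (memLp_haar hv I).toLp I.haar) hC fun s f G => by
      rw [norm_eq_sqrt_integral hv.aemeasurable hv.pos G,
        norm_eq_sqrt_integral hw.aemeasurable.inv hw.inv_pos f]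
      refine le_trans (le_of_eq (Finset.sum_congr rfl fun I _ => ?_))
        (h _ _ (hw.memLp_mul_sqrt_inv f) (memLp_mul_sqrt hv.aemeasurable hv.pos G) s)
      have hσ1 : |σ I| = 1 := by rcases hσ I with h | h <;> simp [h]
      have e : ∫ x, f x * √((w x)⁻¹) * √(w x) * I.haar x = ∫ x, f x * I.haar x := by
        apply integral_congr_ae
        filter_upwards [hw.mul_sqrt_inv_mul_sqrt f] with x hx
        rw [hx]
      rw [hv.inner_toLp, e, LinearMap.smul_apply, smul_eq_mul, abs_mul, hσ1, one_mul,
        hw.haarCoeff_apply, mul_comm]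
  refine ⟨T, hTC, fun f => ?_⟩
  convert hT f using 3 with I
  rw [LinearMap.smul_apply, smul_eq_mul, hw.haarCoeff_apply]

end HaarTwoWeight

end

open HaarTwoWeight in
theorem theorem3p1 (v w : ℝ → ℝ) (hv : IsWeight v) (hw : IsWeight w)
    (h12 : SquareTesting w v) (h13 : SquareTesting v w)
    (hA : IsAInfty v ∨ IsAInfty w) :
    BilinearEstimate v w ∧ T0Bounded v w hv ∧
      (JointA2 v w → HaarMultipliersUniformlyBounded v w hv) :=
  ⟨bilinearEstimate hv hw h12 h13 hA, t0Bounded hv hw h12 h13 hA,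
    haarMultipliersUniformlyBounded hv hw h12 h13 hA⟩
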